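/- For a finite-dimensional real Lie algebra $\mathfrak l$, identify $\Lambda\mathfrak l^*$ with the dual of $\Lambda\mathfrak l$ and let $$P_{\mathfrak l^*}=\{\alpha\in(\Lambda^+\mathfrak l^*)^{\mathfrak l} : \alpha(x\wedge y)=0 \text{ for all } x,y\in(\Lambda^+\mathfrak l)^{\mathfrak l}\}$$ be the space of primitive elements, where $\Lambda^+$ is the positive-degree part and $(\cdot)^{\mathfrak l}$ denotes invariants under the (co)adjoint action. For an involutive automorphism $\theta$ of $\mathfrak l$, let $(P_{\mathfrak l^*})^{-\theta}$ be the $(-1)$-eigenspace of the induced action of $\theta$ on $P_{\mathfrak l^*}$. **Proposition.** Let $\mathfrak g$ be a finite-dimensional real semisimple Lie algebra, $\sigma$ an involution of $\mathfrak g$ (an automorphism with $\sigma^2=1$), $\mathfrak h=\mathfrak g^{\sigma}$, $\mathfrak q=\mathfrak g^{-\sigma}$, and $\theta$ a Cartan involution of $\mathfrak g$ with $\theta\sigma=\sigma\theta$. Let $\mathfrak g^c=\mathfrak h\oplus\sqrt{-1}\,\mathfrak q\subset\mathfrak g_{\mathbb C}=\mathfrak g\otimes_{\mathbb R}\mathbb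 C$, so that $(\mathfrak g^c,\mathfrak h)$ is the $c$-dual of the semisimple symmetric pair $(\mathfrak g,\mathfrak h)$, and let $\theta^c$ be the Cartan involution of $\mathfrak g^c$ given by $\theta^c|_{\mathfrak h}=\theta$ and $\theta^c(\sqrt{-1}\,Y)=-\sqrt{-1}\,\theta(Y)$ for $Y\in\mathfrak q$. Then the restriction map $$(P_{\mathfrak g^*})^{-\theta}\longrightarrow(P_{\mathfrak h^*})^{-\theta}$$ is surjective if and only if the restriction map $$(P_{(\mathfrak g^c)^*})^{-\theta^c}\longrightarrow(P_{\mathfrak h^*})^{-\theta^c}$$ is surjective. -/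

import Mathlib

open TensorProduct

noncomputable section

namespace CDual

/-! ### Primitive elements

For a finite-dimensional Lie algebra `L`, the exterior algebra `Λ L*` is identified with the
dual space of the exterior algebra `Λ L`, so that an element `α` of `Λ L*` is evaluated on
elements of `Λ L`. -/

section Primitive

variable (R : Type*) {L : Type*} [CommRing R] [LieRing L] [LieAlgebra R L]

/-- The algebra map `Λ L → (Λ L)[ε]` that extends `m ↦ m + ε [X, m]`. -/
def adDual (X : L) : ExteriorAlgebra R L →ₐ[R] DualNumber (ExteriorAlgebra R L) :=
  ExteriorAlgebra.lift R
    ⟨(TrivSqZeroExt.inlAlgHom R (ExteriorAlgebra R L) (ExteriorAlgebra R L)).toLinearMap ∘ₗ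
        ExteriorAlgebra.ι R +
      (TrivSqZeroExt.inrHom (ExteriorAlgebra R L) (ExteriorAlgebra R L)).restrictScalars R ∘ₗ
        ExteriorAlgebra.ι R ∘ₗ (LieAlgebra.ad R L X : L →ₗ[R] L), by
      intro m
      ext
      · simp
      · simp [ExteriorAlgebra.ι_add_mul_swap]⟩

theorem adDual_fst (X : L) (w : ExteriorAlgebra R L) : (adDual R X w).fst = w := by
  have h : (TrivSqZeroExt.fstHom R (ExteriorAlgebra R L) (ExteriorAlgebra R L)).comp (adDual R X)
      = AlgHom.id R _ := by
    ext m
    simp [adDual]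
  exact DFunLike.congr_fun h w

/-- The action of `X : L` on `Λ L` induced by the adjoint representation: the derivation that
extends `m ↦ [X, m]` (see `adExt_ι` and `adExt_mul`). -/
def adExt (X : L) : ExteriorAlgebra R L →ₗ[R] ExteriorAlgebra R L :=
  (TrivSqZeroExt.sndHom (ExteriorAlgebra R L) (ExteriorAlgebra R L)).restrictScalars R ∘ₗ
    (adDual R X).toLinearMap

theorem adExt_ι (X m : L) :
    adExt R X (ExteriorAlgebra.ι R m) = ExteriorAlgebra.ι R ⁅X, m⁆ := by
  simp [adExt, adDual]

theorem adExt_mul (X : L) (v w : ExteriorAlgebra R L) :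
    adExt R X (v * w) = adExt R X v * w + v * adExt R X w := by
  simp [adExt, adDual_fst, add_comm]

variable (L)

/-- `(Λ⁺ L)^L`: the invariant elements of `Λ L` without component in degree `0`. -/
def posInvariants : Submodule R (ExteriorAlgebra R L) where
  carrier := {w | ExteriorAlgebra.algebraMapInv w = 0 ∧ ∀ X : L, adExt R X w = 0}
  zero_mem' := by simp
  add_mem' := by
    rintro v w ⟨hv, hv'⟩ ⟨hw, hw'⟩
    exact ⟨by simp [hv, hw], fun X => by simp [hv' X, hw' X]⟩
  smul_mem' := by
    rintro c w ⟨hw, hw'⟩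
    exact ⟨by simp [hw], fun X => by simp [hw' X]⟩

/-- The space `P_{L*}` of primitive elements of `(Λ L*)^L`: the `L`-invariant elements `α` of
`Λ⁺ L*` such that `α (x ∧ y) = 0` for all `x, y` in `(Λ⁺ L)^L`. -/
def primitives : Submodule R (Module.Dual R (ExteriorAlgebra R L)) where
  carrier := {α | α 1 = 0 ∧ (∀ (X : L) (w : ExteriorAlgebra R L), α (adExt R X w) = 0) ∧
    ∀ x ∈ posInvariants R L, ∀ y ∈ posInvariants R L, α (x * y) = 0}
  zero_mem' := by simp
  add_mem' := by
    rintro α β ⟨h1, h2, h3⟩ ⟨k1, k2, k3⟩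
    exact ⟨by simp [h1, k1], fun X w => by simp [h2 X w, k2 X w],
      fun x hx y hy => by simp [h3 x hx y hy, k3 x hx y hy]⟩
  smul_mem' := by
    rintro c α ⟨h1, h2, h3⟩
    exact ⟨by simp [h1], fun X w => by simp [h2 X w], fun x hx y hy => by simp [h3 x hx y hy]⟩

variable {L} {M : Type*} [LieRing M] [LieAlgebra R M]

/-- The pull-back `Λ M* → Λ L*` along a linear map `f : L → M`. -/
def pullback (f : L →ₗ[R] M) :
    Module.Dual R (ExteriorAlgebra R M) →ₗ[R] Module.Dual R (ExteriorAlgebra R L) :=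
  (ExteriorAlgebra.map f).toLinearMap.dualMap

/-- `(P_{L*})^{-f}`: the `(-1)`-eigenspace in `P_{L*}` of the map of `Λ L*` induced by `f`. -/
def antiPrimitives (f : L →ₗ[R] L) : Submodule R (Module.Dual R (ExteriorAlgebra R L)) :=
  primitives R L ⊓ Module.End.eigenspace (pullback R f) (-1)

variable {R}

/-- The restriction `(P_{L*})^{-θ} → (P_{h*})^{-θ}` is surjective, for a subalgebra `h` of `L`
that is stable under `θ`. -/
def RestrictionSurjective (h : LieSubalgebra R L) (θ : L →ₗ⁅R⁆ L) (hθ : ∀ X ∈ h, θ X ∈ h) : Prop :=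
  Set.SurjOn (pullback R (h.incl : h →ₗ[R] L))
    (antiPrimitives R (θ : L →ₗ[R] L))
    (antiPrimitives R (L := h)
      ((θ : L →ₗ[R] L).restrict (p := h.toSubmodule) (q := h.toSubmodule) hθ) :
        Set (Module.Dual R (ExteriorAlgebra R h)))

end Primitive

/-! ### Symmetric pairs and their `c`-duals -/

section Symmetric

variable {g : Type*} [LieRing g] [LieAlgebra ℝ g]

/-- `θ` is a Cartan involution of the semisimple Lie algebra `g`: an involutive automorphism for
which `-B(X, θ Y)` is positive definite, where `B` is the Killing form. -/
def IsCartanInvolution (θ : g →ₗ⁅ℝ⁆ g) : Prop :=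
  Function.Involutive θ ∧ ∀ X : g, X ≠ 0 → 0 < -killingForm ℝ g X (θ X)

/-- `g^σ`, the subalgebra of the fixed points of `σ`. -/
def fixed (σ : g →ₗ⁅ℝ⁆ g) : LieSubalgebra ℝ g where
  carrier := {X | σ X = X}
  zero_mem' := by simp
  add_mem' := by
    intro X Y (hX : σ X = X) (hY : σ Y = Y)
    simp [hX, hY]
  smul_mem' := by
    intro c X (hX : σ X = X)
    simp [hX]
  lie_mem' := by
    intro X Y (hX : σ X = X) (hY : σ Y = Y)
    simp [LieHom.map_lie, hX, hY]

/-- `g^c = h ⊕ √-1 q ⊂ ℂ ⊗ g`, where `h = g^σ` and `q = g^{-σ}`. -/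
def cDual (σ : g →ₗ⁅ℝ⁆ g) : LieSubalgebra ℝ (ℂ ⊗[ℝ] g) where
  carrier := {z | ∃ X Y : g, σ X = X ∧ σ Y = -Y ∧
    z = (1 : ℂ) ⊗ₜ[ℝ] X + Complex.I ⊗ₜ[ℝ] Y}
  zero_mem' := ⟨0, 0, by simp, by simp, by simp⟩
  add_mem' := by
    rintro _ _ ⟨X, Y, hX, hY, rfl⟩ ⟨X', Y', hX', hY', rfl⟩
    refine ⟨X + X', Y + Y', by simp [hX, hX'], by simp [hY, hY', add_comm], ?_⟩
    simp only [tmul_add]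
    abel
  smul_mem' := by
    rintro c _ ⟨X, Y, hX, hY, rfl⟩
    exact ⟨c • X, c • Y, by simp [hX], by simp [hY], by simp only [smul_add, tmul_smul]⟩
  lie_mem' := by
    rintro _ _ ⟨X, Y, hX, hY, rfl⟩ ⟨X', Y', hX', hY', rfl⟩
    refine ⟨⁅X, X'⁆ - ⁅Y, Y'⁆, ⁅X, Y'⁆ + ⁅Y, X'⁆, by simp [LieHom.map_lie, hX, hX', hY, hY'],
      by simp [LieHom.map_lie, hX, hX', hY, hY', add_comm], ?_⟩
    simp only [add_lie, lie_add, LieAlgebra.ExtendScalars.bracket_tmul, one_mul, mul_one,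
      Complex.I_mul_I, tmul_add, tmul_sub, neg_tmul]
    abel

/-- `h = g^σ` as a subalgebra of `g^c`. -/
def cDualFixed (σ : g →ₗ⁅ℝ⁆ g) : LieSubalgebra ℝ (cDual σ) where
  carrier := {z | ∃ X : g, σ X = X ∧ (z : ℂ ⊗[ℝ] g) = (1 : ℂ) ⊗ₜ[ℝ] X}
  zero_mem' := ⟨0, by simp, by simp⟩
  add_mem' := by
    rintro z w ⟨X, hX, hz⟩ ⟨Y, hY, hw⟩
    exact ⟨X + Y, by simp [hX, hY], by simp [hz, hw, tmul_add]⟩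
  smul_mem' := by
    rintro c z ⟨X, hX, hz⟩
    exact ⟨c • X, by simp [hX], by simp [hz]⟩
  lie_mem' := by
    rintro z w ⟨X, hX, hz⟩ ⟨Y, hY, hw⟩
    exact ⟨⁅X, Y⁆, by simp [LieHom.map_lie, hX, hY], by simp [hz, hw]⟩

variable {σ θ : g →ₗ⁅ℝ⁆ g}

theorem map_mem_fixed (hc : ∀ X, θ (σ X) = σ (θ X)) : ∀ X ∈ fixed σ, θ X ∈ fixed σ := by
  intro X (hX : σ X = X)
  change σ (θ X) = θ X
  rw [← hc, hX]

/-- The complex linear extension of `θ ∘ σ` to `ℂ ⊗ g`. -/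
def complexExtension (σ θ : g →ₗ⁅ℝ⁆ g) : ℂ ⊗[ℝ] g →ₗ⁅ℝ⁆ ℂ ⊗[ℝ] g :=
  LieAlgebra.ExtendScalars.map (AlgHom.id ℝ ℂ) (θ.comp σ)

theorem complexExtension_mem (hc : ∀ X, θ (σ X) = σ (θ X)) :
    ∀ z ∈ cDual σ, complexExtension σ θ z ∈ cDual σ := by
  rintro _ ⟨X, Y, hX, hY, rfl⟩
  refine ⟨θ X, -θ Y, by rw [← hc, hX], by rw [map_neg, ← hc, hY, map_neg], ?_⟩
  simp [complexExtension, hX, hY]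

/-- The involution `θ^c` of `g^c`, equal to `θ` on `h` and to `-θ` on `√-1 q`
(see `thetaC_apply`). -/
def thetaC (hc : ∀ X, θ (σ X) = σ (θ X)) : cDual σ →ₗ⁅ℝ⁆ cDual σ where
  toFun z := ⟨complexExtension σ θ z, complexExtension_mem hc z z.2⟩
  map_add' z w := by ext; simp
  map_smul' c z := by ext; simp
  map_lie' {z w} := by ext; simp

theorem thetaC_apply (hc : ∀ X, θ (σ X) = σ (θ X)) (z : cDual σ) (X Y : g)
    (hX : σ X = X) (hY : σ Y = -Y)
    (hz : (z : ℂ ⊗[ℝ] g) = (1 : ℂ) ⊗ₜ[ℝ] X + Complex.I ⊗ₜ[ℝ] Y) :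
    (thetaC hc z : ℂ ⊗[ℝ] g) = (1 : ℂ) ⊗ₜ[ℝ] (θ X) - Complex.I ⊗ₜ[ℝ] (θ Y) := by
  simp [thetaC, complexExtension, hz, hX, hY, sub_eq_add_neg, tmul_neg]

theorem thetaC_mem (hc : ∀ X, θ (σ X) = σ (θ X)) :
    ∀ z ∈ cDualFixed σ, thetaC hc z ∈ cDualFixed σ := by
  rintro z ⟨X, hX, hz⟩
  refine ⟨θ X, by rw [← hc, hX], ?_⟩
  simp [thetaC, complexExtension, hz, hX]

end Symmetric

end CDual

end

noncomputable section

namespace CDual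

open ExteriorAlgebra

/-! ### Functoriality of invariants and primitive elements -/

section Functoriality

variable {R : Type*} [CommRing R] {L M : Type*} [LieRing L] [LieAlgebra R L] [LieRing M]
  [LieAlgebra R M]

/-! The inclusion of `g^c` in `ℂ ⊗ g` is `a + √-1 b`, with `a` and `b` the projections to `h` and
`q`. It extends to an algebra homomorphism `Λ g^c → ℂ ⊗ Λ g` with real part `Re` and imaginary part
`Im`. Since `g = a(ker b) + b(ker a)`, both parts of an invariant are invariant
(`parts_mem_posInvariants`). As `Re (xy) = Re x Re y - Im x Im y`, a primitive `α` on `g` yields a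
primitive `α ∘ Re` on `g^c` (`comp_rePart_mem_primitives`). On `Λ h` the map `Re` is the identity,
so restrictions to `h` are preserved.

The eigenvalue condition needs care: `θ^c` is the restriction of the complex extension of `θσ`, not
of `θ`. Averaging a lift `α` over `σ` repairs this: it keeps `α` primitive, `θ`-anti-invariant and
of the same restriction to `h`, where `σ` is trivial, and then `θσ` acts by `-1` as well. This gives
one implication (`IsDuality.restrictionSurjective`). The relation of being `c`-dual is symmetric
(`IsDuality.symm`), which gives the other. -/

theorem adExt_algebraMap (X : L) (r : R) :
    adExt R X (algebraMap R (ExteriorAlgebra R L) r) = 0 := by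
  simp [adExt, TrivSqZeroExt.algebraMap_eq_inl']

theorem adExt_add (X Y : L) (w : ExteriorAlgebra R L) :
    adExt R (X + Y) w = adExt R X w + adExt R Y w := by
  induction w using ExteriorAlgebra.induction with
  | algebraMap r => simp [adExt_algebraMap]
  | ι m => simp [adExt_ι]
  | mul a b ha hb => rw [adExt_mul, adExt_mul, adExt_mul, ha, hb]; noncomm_ring
  | add a b ha hb => rw [map_add, map_add, map_add, ha, hb]; abel

theorem adExt_map (e : L →ₗ⁅R⁆ M) (X : L) (w : ExteriorAlgebra R L) :
    adExt R (e X) (ExteriorAlgebra.map (e : L →ₗ[R] M) w)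
      = ExteriorAlgebra.map (e : L →ₗ[R] M) (adExt R X w) := by
  induction w using ExteriorAlgebra.induction with
  | algebraMap r => simp [adExt_algebraMap]
  | ι m => simp [adExt_ι]
  | mul a b ha hb => simp only [map_mul, adExt_mul, ha, hb, map_add]
  | add a b ha hb => simp only [map_add, ha, hb]

theorem algebraMapInv_map (f : L →ₗ[R] M) (w : ExteriorAlgebra R L) :
    algebraMapInv (ExteriorAlgebra.map f w) = algebraMapInv w := by
  have h : (algebraMapInv (R := R) (M := M)).comp (ExteriorAlgebra.map f) = algebraMapInv := by
    ext m
    simp [algebraMapInv]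
  exact DFunLike.congr_fun h w

/-- Equivariance only gives invariance under the image of `e`; surjectivity makes that all of `M`.
-/
theorem map_mem_posInvariants (e : L →ₗ⁅R⁆ M) (he : Function.Surjective e)
    {w : ExteriorAlgebra R L} (hw : w ∈ posInvariants R L) :
    ExteriorAlgebra.map (e : L →ₗ[R] M) w ∈ posInvariants R M := by
  refine ⟨by rw [algebraMapInv_map, hw.1], fun X => ?_⟩
  obtain ⟨Z, rfl⟩ := he X
  rw [adExt_map, hw.2, map_zero]

@[simp]
theorem pullback_apply (f : L →ₗ[R] M) (α : Module.Dual R (ExteriorAlgebra R M))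
    (w : ExteriorAlgebra R L) : pullback R f α w = α (ExteriorAlgebra.map f w) := rfl

/-- Primitive elements pull back to primitive elements along surjective homomorphisms. -/
theorem pullback_mem_primitives (e : L →ₗ⁅R⁆ M) (he : Function.Surjective e)
    {α : Module.Dual R (ExteriorAlgebra R M)} (hα : α ∈ primitives R M) :
    pullback R (e : L →ₗ[R] M) α ∈ primitives R L := by
  refine ⟨by simpa using hα.1, fun X w => ?_, fun x hx y hy => ?_⟩
  · rw [pullback_apply, ← adExt_map, hα.2.1]
  · rw [pullback_apply, map_mul]
    exact hα.2.2 _ (map_mem_posInvariants e he hx) _ (map_mem_posInvariants e he hy)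

theorem mem_antiPrimitives {f : L →ₗ[R] L} {α : Module.Dual R (ExteriorAlgebra R L)} :
    α ∈ antiPrimitives R f ↔
      α ∈ primitives R L ∧ ∀ w, α (ExteriorAlgebra.map f w) = -α w := by
  rw [antiPrimitives, Submodule.mem_inf, Module.End.mem_eigenspace_iff, LinearMap.ext_iff]
  simp

theorem map_map_apply {N : Type*} [AddCommGroup N] [Module R N] (f : L →ₗ[R] M) (k : M →ₗ[R] N)
    (w : ExteriorAlgebra R L) :
    ExteriorAlgebra.map k (ExteriorAlgebra.map f w) = ExteriorAlgebra.map (k ∘ₗ f) w := by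
  rw [← ExteriorAlgebra.map_comp_map]; rfl

end Functoriality

/-! ### Real and imaginary parts in a complexified algebra -/

section Parts

variable {A : Type*} [Ring A] [Algebra ℝ A]

/-- The real part `ℂ ⊗ A → A`. -/
def tensorRe : ℂ ⊗[ℝ] A →ₗ[ℝ] A :=
  (TensorProduct.lid ℝ A).toLinearMap ∘ₗ LinearMap.rTensor A Complex.reLm

/-- The imaginary part `ℂ ⊗ A → A`. -/
def tensorIm : ℂ ⊗[ℝ] A →ₗ[ℝ] A :=
  (TensorProduct.lid ℝ A).toLinearMap ∘ₗ LinearMap.rTensor A Complex.imLm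

@[simp]
theorem tensorRe_tmul (c : ℂ) (a : A) : tensorRe (c ⊗ₜ[ℝ] a) = c.re • a := by simp [tensorRe]

@[simp]
theorem tensorIm_tmul (c : ℂ) (a : A) : tensorIm (c ⊗ₜ[ℝ] a) = c.im • a := by simp [tensorIm]

theorem tensorRe_mul (s t : ℂ ⊗[ℝ] A) :
    tensorRe (s * t) = tensorRe s * tensorRe t - tensorIm s * tensorIm t := by
  induction s with
  | zero => simp
  | add a b ha hb => simp only [add_mul, map_add, ha, hb]; abel
  | tmul c a =>
    induction t with
    | zero => simp
    | add x y hx hy => simp only [mul_add, map_add, hx, hy]; abel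
    | tmul d b => simp [sub_smul, smul_smul, mul_comm]

theorem tensorIm_mul (s t : ℂ ⊗[ℝ] A) :
    tensorIm (s * t) = tensorRe s * tensorIm t + tensorIm s * tensorRe t := by
  induction s with
  | zero => simp
  | add a b ha hb => simp only [add_mul, map_add, ha, hb]; abel
  | tmul c a =>
    induction t with
    | zero => simp
    | add x y hx hy => simp only [mul_add, map_add, hx, hy]; abel
    | tmul d b => simp [add_smul, smul_smul, mul_comm]

end Parts

/-! ### The exterior algebra homomorphism extending `a + √-1 b` -/

section ComplexMap

variable {V W : Type*} [AddCommGroup V] [Module ℝ V] [AddCommGroup W] [Module ℝ W]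

/-- The algebra homomorphism `Λ V → ℂ ⊗ Λ W` that extends `v ↦ a v + √-1 b v`. -/
def complexMap (a b : V →ₗ[ℝ] W) :
    ExteriorAlgebra ℝ V →ₐ[ℝ] ℂ ⊗[ℝ] ExteriorAlgebra ℝ W :=
  ExteriorAlgebra.lift ℝ
    ⟨TensorProduct.mk ℝ ℂ _ 1 ∘ₗ ExteriorAlgebra.ι ℝ ∘ₗ a +
        TensorProduct.mk ℝ ℂ _ Complex.I ∘ₗ ExteriorAlgebra.ι ℝ ∘ₗ b, by
      intro v
      simp only [LinearMap.add_apply, LinearMap.comp_apply, TensorProduct.mk_apply, add_mul,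
        mul_add, Algebra.TensorProduct.tmul_mul_tmul, one_mul, mul_one, ι_sq_zero, tmul_zero,
        zero_add, add_zero, ← tmul_add, ι_add_mul_swap]⟩

/-- The real part of `complexMap`. -/
def rePart (a b : V →ₗ[ℝ] W) : ExteriorAlgebra ℝ V →ₗ[ℝ] ExteriorAlgebra ℝ W :=
  tensorRe ∘ₗ (complexMap a b).toLinearMap

/-- The imaginary part of `complexMap`. -/
def imPart (a b : V →ₗ[ℝ] W) : ExteriorAlgebra ℝ V →ₗ[ℝ] ExteriorAlgebra ℝ W :=
  tensorIm ∘ₗ (complexMap a b).toLinearMap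

variable (a b : V →ₗ[ℝ] W)

@[simp]
theorem rePart_algebraMap (r : ℝ) : rePart a b (algebraMap ℝ _ r) = algebraMap ℝ _ r := by
  rw [rePart, LinearMap.comp_apply, AlgHom.toLinearMap_apply, AlgHom.commutes,
    Algebra.TensorProduct.algebraMap_apply, tensorRe_tmul]
  simp [Algebra.algebraMap_eq_smul_one]

@[simp]
theorem imPart_algebraMap (r : ℝ) : imPart a b (algebraMap ℝ _ r) = 0 := by
  simp [imPart, Algebra.TensorProduct.algebraMap_apply]

@[simp]
theorem rePart_ι (v : V) : rePart a b (ι ℝ v) = ι ℝ (a v) := by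
  simp [rePart, complexMap]

@[simp]
theorem imPart_ι (v : V) : imPart a b (ι ℝ v) = ι ℝ (b v) := by
  simp [imPart, complexMap]

theorem rePart_mul (v w : ExteriorAlgebra ℝ V) :
    rePart a b (v * w) = rePart a b v * rePart a b w - imPart a b v * imPart a b w := by
  simp [rePart, imPart, tensorRe_mul]

theorem imPart_mul (v w : ExteriorAlgebra ℝ V) :
    imPart a b (v * w) = rePart a b v * imPart a b w + imPart a b v * rePart a b w := by
  simp [rePart, imPart, tensorIm_mul]

/-- Scalars are real and generators stay in degree one, so no imaginary scalar can arise. Hence both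
parts preserve positive degree. -/
theorem algebraMapInv_parts (w : ExteriorAlgebra ℝ V) :
    algebraMapInv (rePart a b w) = algebraMapInv w ∧ algebraMapInv (imPart a b w) = 0 := by
  induction w using ExteriorAlgebra.induction with
  | algebraMap r => simp
  | ι m => simp [algebraMapInv]
  | mul x y hx hy => simp [rePart_mul, imPart_mul, hx, hy]
  | add x y hx hy => simp [hx, hy]

theorem parts_map (f : V →ₗ[ℝ] V) (k : W →ₗ[ℝ] W) (ha : ∀ v, a (f v) = k (a v))
    (hb : ∀ v, b (f v) = k (b v)) (w : ExteriorAlgebra ℝ V) :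
    rePart a b (ExteriorAlgebra.map f w) = ExteriorAlgebra.map k (rePart a b w) ∧
      imPart a b (ExteriorAlgebra.map f w) = ExteriorAlgebra.map k (imPart a b w) := by
  induction w using ExteriorAlgebra.induction with
  | algebraMap r => simp
  | ι m => simp [ha, hb]
  | mul x y hx hy => simp [rePart_mul, imPart_mul, hx, hy]
  | add x y hx hy => simp [hx, hy]

theorem parts_map_of_eq_zero {U : Type*} [AddCommGroup U] [Module ℝ U] (j : U →ₗ[ℝ] V)
    (hb : ∀ u, b (j u) = 0) (w : ExteriorAlgebra ℝ U) :
    rePart a b (ExteriorAlgebra.map j w) = ExteriorAlgebra.map (a ∘ₗ j) w ∧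
      imPart a b (ExteriorAlgebra.map j w) = 0 := by
  induction w using ExteriorAlgebra.induction with
  | algebraMap r => simp
  | ι m => simp [hb]
  | mul x y hx hy => simp [rePart_mul, imPart_mul, hx, hy]
  | add x y hx hy => simp [hx, hy]

end ComplexMap

/-! ### Complex-valued Lie homomorphisms and primitive elements -/

section LieComplexMap

variable {g g' : Type*} [LieRing g] [LieAlgebra ℝ g] [LieRing g'] [LieAlgebra ℝ g']

/-- The hypotheses say that `a + √-1 b` is a Lie homomorphism into `ℂ ⊗ g`; its extension to `Λ g'`
is then equivariant, and these are the two parts of that equivariance. -/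
theorem parts_adExt (a b : g' →ₗ[ℝ] g)
    (ha : ∀ x y, a ⁅x, y⁆ = ⁅a x, a y⁆ - ⁅b x, b y⁆)
    (hb : ∀ x y, b ⁅x, y⁆ = ⁅a x, b y⁆ + ⁅b x, a y⁆)
    (z : g') (w : ExteriorAlgebra ℝ g') :
    rePart a b (adExt ℝ z w)
        = adExt ℝ (a z) (rePart a b w) - adExt ℝ (b z) (imPart a b w) ∧
      imPart a b (adExt ℝ z w)
        = adExt ℝ (a z) (imPart a b w) + adExt ℝ (b z) (rePart a b w) := by
  induction w using ExteriorAlgebra.induction with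
  | algebraMap r => simp [adExt_algebraMap]
  | ι m => simp [adExt_ι, ha, hb]
  | mul x y hx hy =>
    simp only [adExt_mul, map_add, map_sub, rePart_mul, imPart_mul, hx, hy]
    constructor <;> noncomm_ring
  | add x y hx hy =>
    simp only [map_add, hx, hy]
    constructor <;> abel

/-- If `a + √-1 b` is a homomorphism `g' → ℂ ⊗ g` such that `g` is spanned by the values of `a` on
`ker b` and those of `b` on `ker a`, then the real and imaginary parts of invariants are
invariants. -/
theorem parts_mem_posInvariants (a b : g' →ₗ[ℝ] g)
    (ha : ∀ x y, a ⁅x, y⁆ = ⁅a x, a y⁆ - ⁅b x, b y⁆)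
    (hb : ∀ x y, b ⁅x, y⁆ = ⁅a x, b y⁆ + ⁅b x, a y⁆)
    (hs : ∀ X : g, ∃ x y, b x = 0 ∧ a y = 0 ∧ a x + b y = X)
    {w : ExteriorAlgebra ℝ g'} (hw : w ∈ posInvariants ℝ g') :
    rePart a b w ∈ posInvariants ℝ g ∧ imPart a b w ∈ posInvariants ℝ g := by
  have h0 : ∀ v : ExteriorAlgebra ℝ g, adExt ℝ (0 : g) v = 0 := fun v => by
    simpa using adExt_add (0 : g) 0 v
  have key : ∀ X, adExt ℝ X (rePart a b w) = 0 ∧ adExt ℝ X (imPart a b w) = 0 := by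
    intro X
    obtain ⟨x, y, hx, hy, rfl⟩ := hs X
    -- As `b x = 0`, invariance under `x` kills both parts under `a x`; as `a y = 0`, invariance
    -- under `y` does so under `b y`, with the parts interchanged.
    have h1 := parts_adExt a b ha hb x w
    have h2 := parts_adExt a b ha hb y w
    simp only [hw.2, map_zero, hx, hy, h0, sub_zero, add_zero, zero_add, zero_sub] at h1 h2
    rw [adExt_add, adExt_add, ← h1.1, ← h1.2, ← h2.2, neg_eq_zero.1 h2.1.symm]
    simp
  refine ⟨⟨?_, fun X => (key X).1⟩, ⟨(algebraMapInv_parts a b w).2, fun X => (key X).2⟩⟩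
  rw [(algebraMapInv_parts a b w).1, hw.1]

theorem comp_rePart_mem_primitives (a b : g' →ₗ[ℝ] g)
    (ha : ∀ x y, a ⁅x, y⁆ = ⁅a x, a y⁆ - ⁅b x, b y⁆)
    (hb : ∀ x y, b ⁅x, y⁆ = ⁅a x, b y⁆ + ⁅b x, a y⁆)
    (hs : ∀ X : g, ∃ x y, b x = 0 ∧ a y = 0 ∧ a x + b y = X)
    {α : Module.Dual ℝ (ExteriorAlgebra ℝ g)} (hα : α ∈ primitives ℝ g) :
    α ∘ₗ rePart a b ∈ primitives ℝ g' := by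
  refine ⟨?_, fun X w => ?_, fun x hx y hy => ?_⟩
  · have := rePart_algebraMap a b 1
    rw [(algebraMap ℝ (ExteriorAlgebra ℝ g')).map_one,
      (algebraMap ℝ (ExteriorAlgebra ℝ g)).map_one] at this
    rw [LinearMap.comp_apply, this, hα.1]
  · rw [LinearMap.comp_apply, (parts_adExt a b ha hb X w).1, map_sub, hα.2.1, hα.2.1, sub_zero]
  · obtain ⟨hx1, hx2⟩ := parts_mem_posInvariants a b ha hb hs hx
    obtain ⟨hy1, hy2⟩ := parts_mem_posInvariants a b ha hb hs hy
    rw [LinearMap.comp_apply, rePart_mul, map_sub, hα.2.2 _ hx1 _ hy1, hα.2.2 _ hx2 _ hy2,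
      sub_zero]

end LieComplexMap

/-! ### Pairs of symmetric Lie algebras that are `c`-dual to each other -/

section Dual

variable {g g' : Type*} [LieRing g] [LieAlgebra ℝ g] [LieRing g'] [LieAlgebra ℝ g']

/-- `T : g' ≃ g` exhibits `(g', σ')` as the `c`-dual of `(g, σ)`: it is compatible with the
involutions and with the brackets, up to a sign for the bracket of two `σ'`-odd elements. -/
structure IsDuality (σ : g →ₗ⁅ℝ⁆ g) (σ' : g' →ₗ⁅ℝ⁆ g') (T : g' ≃ₗ[ℝ] g) : Prop where
  involutive : Function.Involutive σ
  involutive' : Function.Involutive σ'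
  comm : ∀ z, T (σ' z) = σ (T z)
  lie_even : ∀ x y, σ' x = x → T ⁅x, y⁆ = ⁅T x, T y⁆
  lie_odd : ∀ x y, σ' x = -x → σ' y = -y → T ⁅x, y⁆ = -⁅T x, T y⁆

namespace IsDuality

variable {σ : g →ₗ⁅ℝ⁆ g} {σ' : g' →ₗ⁅ℝ⁆ g'} {T : g' ≃ₗ[ℝ] g}

theorem comm_symm (hT : IsDuality σ σ' T) (X : g) : T.symm (σ X) = σ' (T.symm X) := by
  rw [LinearEquiv.symm_apply_eq, hT.comm, LinearEquiv.apply_symm_apply]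

theorem symm (hT : IsDuality σ σ' T) : IsDuality σ' σ T.symm where
  involutive := hT.involutive'
  involutive' := hT.involutive
  comm := hT.comm_symm
  lie_even x y hx := by
    rw [LinearEquiv.symm_apply_eq, hT.lie_even _ _ (by rw [← hT.comm_symm, hx])]
    simp
  lie_odd x y hx hy := by
    rw [LinearEquiv.symm_apply_eq, map_neg, hT.lie_odd _ _ (by rw [← hT.comm_symm, hx, map_neg])
      (by rw [← hT.comm_symm, hy, map_neg])]
    simp

/-- The `σ'`-even part of `T`. -/
def even (σ' : g' →ₗ⁅ℝ⁆ g') (T : g' ≃ₗ[ℝ] g) : g' →ₗ[ℝ] g :=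
  (2⁻¹ : ℝ) • (T.toLinearMap ∘ₗ (LinearMap.id + (σ' : g' →ₗ[ℝ] g')))

/-- The `σ'`-odd part of `T`. -/
def odd (σ' : g' →ₗ⁅ℝ⁆ g') (T : g' ≃ₗ[ℝ] g) : g' →ₗ[ℝ] g :=
  (2⁻¹ : ℝ) • (T.toLinearMap ∘ₗ (LinearMap.id - (σ' : g' →ₗ[ℝ] g')))

theorem even_apply_of_even {z : g'} (hz : σ' z = z) : even σ' T z = T z := by
  simp only [even, LinearMap.smul_apply, LinearMap.comp_apply, LinearMap.add_apply,
    LinearMap.id_apply, LieHom.coe_toLinearMap, hz, LinearEquiv.coe_coe, map_add]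
  module

theorem odd_apply_of_even {z : g'} (hz : σ' z = z) : odd σ' T z = 0 := by
  simp [odd, hz]

theorem even_apply_of_odd {z : g'} (hz : σ' z = -z) : even σ' T z = 0 := by
  simp [even, hz]

theorem odd_apply_of_odd {z : g'} (hz : σ' z = -z) : odd σ' T z = T z := by
  simp only [odd, LinearMap.smul_apply, LinearMap.comp_apply, LinearMap.sub_apply,
    LinearMap.id_apply, LieHom.coe_toLinearMap, hz, LinearEquiv.coe_coe, map_sub, map_neg]
  module

theorem exists_even_odd (hT : IsDuality σ σ' T) (z : g') :
    ∃ x y, σ' x = x ∧ σ' y = -y ∧ x + y = z := by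
  refine ⟨(2⁻¹ : ℝ) • (z + σ' z), (2⁻¹ : ℝ) • (z - σ' z), ?_, ?_, by module⟩
  · rw [map_smul, map_add, hT.involutive', add_comm]
  · rw [map_smul, map_sub, hT.involutive', ← smul_neg, neg_sub]

/-- `even + √-1 odd` is a homomorphism to `ℂ ⊗ g`: the sign in `lie_odd` is `(√-1)²`. -/
theorem parts_lie (hT : IsDuality σ σ' T) (z w : g') :
    even σ' T ⁅z, w⁆ = ⁅even σ' T z, even σ' T w⁆ - ⁅odd σ' T z, odd σ' T w⁆ ∧
      odd σ' T ⁅z, w⁆ = ⁅even σ' T z, odd σ' T w⁆ + ⁅odd σ' T z, even σ' T w⁆ := by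
  obtain ⟨x, y, hx, hy, rfl⟩ := hT.exists_even_odd z
  obtain ⟨u, v, hu, hv, rfl⟩ := hT.exists_even_odd w
  have h1 : σ' ⁅x, u⁆ = ⁅x, u⁆ := by rw [LieHom.map_lie, hx, hu]
  have h2 : σ' ⁅x, v⁆ = -⁅x, v⁆ := by rw [LieHom.map_lie, hx, hv, lie_neg]
  have h3 : σ' ⁅y, u⁆ = -⁅y, u⁆ := by rw [LieHom.map_lie, hy, hu, neg_lie]
  have h4 : σ' ⁅y, v⁆ = ⁅y, v⁆ := by rw [LieHom.map_lie, hy, hv, neg_lie, lie_neg, neg_neg]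
  -- `lie_even` requires the even element on the left, hence the skew-symmetry.
  have h5 : T ⁅y, u⁆ = ⁅T y, T u⁆ := by
    rw [← lie_skew, map_neg, hT.lie_even _ _ hu, lie_skew]
  simp only [add_lie, lie_add, map_add, even_apply_of_even hx, even_apply_of_even hu,
    even_apply_of_odd hy, even_apply_of_odd hv, odd_apply_of_even hx, odd_apply_of_even hu,
    odd_apply_of_odd hy, odd_apply_of_odd hv, even_apply_of_even h1, even_apply_of_even h4,
    even_apply_of_odd h2, even_apply_of_odd h3, odd_apply_of_even h1, odd_apply_of_even h4,
    odd_apply_of_odd h2, odd_apply_of_odd h3, add_zero, zero_add, hT.lie_even _ _ hx,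
    hT.lie_odd _ _ hy hv, h5]
  exact ⟨by abel, by abel⟩

theorem exists_parts (hT : IsDuality σ σ' T) (X : g) :
    ∃ x y, odd σ' T x = 0 ∧ even σ' T y = 0 ∧ even σ' T x + odd σ' T y = X := by
  obtain ⟨x, y, hx, hy, hxy⟩ := hT.exists_even_odd (T.symm X)
  refine ⟨x, y, odd_apply_of_even hx, even_apply_of_odd hy, ?_⟩
  rw [even_apply_of_even hx, odd_apply_of_odd hy, ← map_add, hxy, LinearEquiv.apply_symm_apply]

variable {h : LieSubalgebra ℝ g} {h' : LieSubalgebra ℝ g'}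

/-- A duality restricts to an isomorphism between the subalgebras of fixed points. -/
def fixedEquiv (hT : IsDuality σ σ' T) (hh : ∀ X, X ∈ h ↔ σ X = X)
    (hh' : ∀ z, z ∈ h' ↔ σ' z = z) : h' ≃ₗ⁅ℝ⁆ h where
  toFun z := ⟨T z, by rw [hh, ← hT.comm, (hh' _).1 z.2]⟩
  invFun X := ⟨T.symm X, by rw [hh', ← hT.comm_symm, (hh _).1 X.2]⟩
  left_inv z := by simp
  right_inv X := by simp
  map_add' x y := by ext; simp
  map_smul' c x := by ext; simp
  map_lie' {x y} := by
    ext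
    simpa using hT.lie_even _ _ ((hh' _).1 x.2)

/-- Surjectivity of the restriction map passes from a symmetric pair to its `c`-dual. -/
theorem restrictionSurjective (hT : IsDuality σ σ' T) (hh : ∀ X, X ∈ h ↔ σ X = X)
    (hh' : ∀ z, z ∈ h' ↔ σ' z = z) {θ : g →ₗ⁅ℝ⁆ g} {θ' : g' →ₗ⁅ℝ⁆ g'}
    (hc : ∀ X, θ (σ X) = σ (θ X)) (hθ : ∀ z, T (θ' z) = θ (σ (T z)))
    (hm : ∀ X ∈ h, θ X ∈ h) (hm' : ∀ z ∈ h', θ' z ∈ h')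
    (hsurj : RestrictionSurjective h θ hm) : RestrictionSurjective h' θ' hm' := by
  intro β' hβ'
  obtain ⟨hβ'p, hβ'θ⟩ := mem_antiPrimitives.1 hβ'
  let e := hT.fixedEquiv hh hh'
  -- On the fixed points `σ` is trivial, so `T` intertwines `θ'` with `θ` itself there.
  have hβ : pullback ℝ ((e.symm : h →ₗ⁅ℝ⁆ h') : h →ₗ[ℝ] h') β' ∈ antiPrimitives ℝ (L := h)
      ((θ : g →ₗ[ℝ] g).restrict (p := h.toSubmodule) (q := h.toSubmodule) hm) := by
    refine mem_antiPrimitives.2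
      ⟨pullback_mem_primitives (e.symm : h →ₗ⁅ℝ⁆ h') e.symm.surjective hβ'p, fun w => ?_⟩
    rw [pullback_apply, pullback_apply, ← hβ'θ, map_map_apply, map_map_apply]
    congr 3
    ext X
    change T.symm (θ X) = θ' (T.symm X)
    rw [LinearEquiv.symm_apply_eq, hθ, LinearEquiv.apply_symm_apply, (hh _).1 X.2]
  obtain ⟨α, hα, hres⟩ := hsurj hβ
  obtain ⟨hαp, hαθ⟩ := mem_antiPrimitives.1 hα
  -- The average over `σ` is `σ`-invariant, so that `θσ`, the counterpart of `θ'` under `T`, acts on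
  -- it by `-1`.
  let α₀ := (2⁻¹ : ℝ) • (α + pullback ℝ (σ : g →ₗ[ℝ] g) α)
  have hα₀ : α₀ ∈ primitives ℝ g := Submodule.smul_mem _ _
    (Submodule.add_mem _ hαp (pullback_mem_primitives σ hT.involutive.surjective hαp))
  have hσσ : ∀ w, ExteriorAlgebra.map (σ : g →ₗ[ℝ] g) (ExteriorAlgebra.map (σ : g →ₗ[ℝ] g) w)
      = w := by
    intro w
    have h1 : (σ : g →ₗ[ℝ] g) ∘ₗ (σ : g →ₗ[ℝ] g) = LinearMap.id := by
      ext X; exact hT.involutive X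
    rw [map_map_apply, h1, ExteriorAlgebra.map_id]; rfl
  have hσθ : ∀ w, ExteriorAlgebra.map (σ : g →ₗ[ℝ] g) (ExteriorAlgebra.map (θ : g →ₗ[ℝ] g) w)
      = ExteriorAlgebra.map (θ : g →ₗ[ℝ] g) (ExteriorAlgebra.map (σ : g →ₗ[ℝ] g) w) := by
    intro w
    rw [map_map_apply, map_map_apply]
    congr 2
    ext X; exact (hc X).symm
  have hα₀θ : ∀ w, α₀ (ExteriorAlgebra.map ((θ : g →ₗ[ℝ] g) ∘ₗ (σ : g →ₗ[ℝ] g)) w) = -α₀ w := by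
    intro w
    rw [← map_map_apply]
    simp only [α₀, LinearMap.smul_apply, LinearMap.add_apply, pullback_apply, hσθ, hσσ, hαθ,
      smul_eq_mul]
    ring
  refine ⟨α₀ ∘ₗ rePart (even σ' T) (odd σ' T), mem_antiPrimitives.2 ⟨?_, fun w => ?_⟩, ?_⟩
  · exact comp_rePart_mem_primitives _ _ (fun x y => (hT.parts_lie x y).1)
      (fun x y => (hT.parts_lie x y).2) hT.exists_parts hα₀
  · have hσθ' : ∀ z, σ' (θ' z) = θ' (σ' z) := fun z => T.injective <| by
      rw [hT.comm, hθ, hθ, hT.comm, ← hc]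
    rw [LinearMap.comp_apply, (parts_map _ _ (θ' : g' →ₗ[ℝ] g')
      ((θ : g →ₗ[ℝ] g) ∘ₗ (σ : g →ₗ[ℝ] g)) ?_ ?_ w).1, hα₀θ, LinearMap.comp_apply]
    · intro z; simp [even, hσθ', hθ]
    · intro z; simp [odd, hσθ', hθ, hT.comm]
  · refine LinearMap.ext fun w => ?_
    -- On `h'` the odd part vanishes and the even part is `e`, so the real part restricts to `Λ e`.
    have h1 : (odd σ' T ∘ₗ (h'.incl : h' →ₗ[ℝ] g')) = 0 := by
      ext z; exact odd_apply_of_even ((hh' _).1 z.2)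
    have h2 : even σ' T ∘ₗ (h'.incl : h' →ₗ[ℝ] g')
        = (h.incl : h →ₗ[ℝ] g) ∘ₗ ((e : h' →ₗ⁅ℝ⁆ h) : h' →ₗ[ℝ] h) := by
      ext z; exact even_apply_of_even ((hh' _).1 z.2)
    have h3 : (σ : g →ₗ[ℝ] g) ∘ₗ (h.incl : h →ₗ[ℝ] g) = h.incl := by
      ext X; exact (hh _).1 X.2
    have h4 : ((e.symm : h →ₗ⁅ℝ⁆ h') : h →ₗ[ℝ] h') ∘ₗ ((e : h' →ₗ⁅ℝ⁆ h) : h' →ₗ[ℝ] h)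
        = LinearMap.id := by
      ext z; exact congrArg Subtype.val (e.symm_apply_apply z)
    rw [pullback_apply, LinearMap.comp_apply,
      (parts_map_of_eq_zero _ _ _ (fun u => LinearMap.congr_fun h1 u) w).1, h2, ← map_map_apply]
    have h5 := LinearMap.congr_fun hres
      (ExteriorAlgebra.map ((e : h' →ₗ⁅ℝ⁆ h) : h' →ₗ[ℝ] h) w)
    rw [pullback_apply, pullback_apply, map_map_apply _ _ w, map_map_apply _ _ w, h4, ExteriorAlgebra.map_id] at h5
    simp only [α₀, LinearMap.smul_apply, LinearMap.add_apply, pullback_apply,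
      map_map_apply _ _ w, ← LinearMap.comp_assoc, h3, h5, smul_eq_mul, AlgHom.id_apply]
    ring

end IsDuality

end Dual

/-! ### The duality between `g^c` and `g` -/

section CDualEquiv

variable {g : Type*} [LieRing g] [LieAlgebra ℝ g] {σ : g →ₗ⁅ℝ⁆ g}

/-- The involution of `g^c` with fixed point algebra `h`. -/
def sigmaC (σ : g →ₗ⁅ℝ⁆ g) : cDual σ →ₗ⁅ℝ⁆ cDual σ :=
  thetaC (σ := σ) (θ := LieHom.id) fun _ => rfl

theorem sigmaC_apply (z : cDual σ) (X Y : g) (hX : σ X = X) (hY : σ Y = -Y)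
    (hz : (z : ℂ ⊗[ℝ] g) = (1 : ℂ) ⊗ₜ[ℝ] X + Complex.I ⊗ₜ[ℝ] Y) :
    (sigmaC σ z : ℂ ⊗[ℝ] g) = (1 : ℂ) ⊗ₜ[ℝ] X - Complex.I ⊗ₜ[ℝ] Y :=
  thetaC_apply _ z X Y hX hY hz

/-- The linear map `ℂ ⊗ g → g` with `1 ⊗ X + √-1 ⊗ Y ↦ X + Y`. -/
def tensorSum (g : Type*) [AddCommGroup g] [Module ℝ g] : ℂ ⊗[ℝ] g →ₗ[ℝ] g :=
  (TensorProduct.lid ℝ g).toLinearMap ∘ₗ LinearMap.rTensor g (Complex.reLm + Complex.imLm)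

@[simp]
theorem tensorSum_apply (X Y : g) :
    tensorSum g ((1 : ℂ) ⊗ₜ[ℝ] X + Complex.I ⊗ₜ[ℝ] Y) = X + Y := by
  simp [tensorSum]

/-- The linear isomorphism `g^c ≃ g` with `X + √-1 Y ↦ X + Y`. -/
def cDualEquiv (hσ : Function.Involutive σ) : cDual σ ≃ₗ[ℝ] g where
  toFun z := tensorSum g z
  map_add' z w := by simp
  map_smul' c z := by simp
  invFun Z := ⟨(1 : ℂ) ⊗ₜ[ℝ] ((2⁻¹ : ℝ) • (Z + σ Z)) + Complex.I ⊗ₜ[ℝ] ((2⁻¹ : ℝ) • (Z - σ Z)),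
    _, _, by rw [map_smul, map_add, hσ, add_comm],
    by rw [map_smul, map_sub, hσ, ← smul_neg, neg_sub], rfl⟩
  left_inv := by
    rintro ⟨_, X, Y, hX, hY, rfl⟩
    ext
    change (1 : ℂ) ⊗ₜ[ℝ] ((2⁻¹ : ℝ) • (tensorSum g ((1 : ℂ) ⊗ₜ[ℝ] X + Complex.I ⊗ₜ[ℝ] Y) +
        σ (tensorSum g ((1 : ℂ) ⊗ₜ[ℝ] X + Complex.I ⊗ₜ[ℝ] Y)))) +
      Complex.I ⊗ₜ[ℝ] ((2⁻¹ : ℝ) • (tensorSum g ((1 : ℂ) ⊗ₜ[ℝ] X + Complex.I ⊗ₜ[ℝ] Y) -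
        σ (tensorSum g ((1 : ℂ) ⊗ₜ[ℝ] X + Complex.I ⊗ₜ[ℝ] Y)))) =
      (1 : ℂ) ⊗ₜ[ℝ] X + Complex.I ⊗ₜ[ℝ] Y
    rw [tensorSum_apply, map_add, hX, hY]
    congr 2 <;> module
  right_inv Z := by
    simp only [tensorSum_apply]
    module

theorem cDualEquiv_apply (hσ : Function.Involutive σ) (z : cDual σ) (X Y : g)
    (hz : (z : ℂ ⊗[ℝ] g) = (1 : ℂ) ⊗ₜ[ℝ] X + Complex.I ⊗ₜ[ℝ] Y) :
    cDualEquiv hσ z = X + Y := by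
  change tensorSum g z = _
  rw [hz, tensorSum_apply]

theorem cDualEquiv_sigmaC (hσ : Function.Involutive σ) (z : cDual σ) :
    cDualEquiv hσ (sigmaC σ z) = σ (cDualEquiv hσ z) := by
  obtain ⟨X, Y, hX, hY, hz⟩ := z.2
  rw [cDualEquiv_apply hσ z X Y hz, cDualEquiv_apply hσ (sigmaC σ z) X (-Y)
    (by rw [sigmaC_apply z X Y hX hY hz, tmul_neg, sub_eq_add_neg]), map_add, hX, hY]

theorem coe_of_sigmaC_eq (hσ : Function.Involutive σ) {z : cDual σ} (hz : sigmaC σ z = z) :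
    σ (cDualEquiv hσ z) = cDualEquiv hσ z ∧
      (z : ℂ ⊗[ℝ] g) = (1 : ℂ) ⊗ₜ[ℝ] cDualEquiv hσ z := by
  have h := cDualEquiv_sigmaC hσ z
  rw [hz] at h
  refine ⟨h.symm, ?_⟩
  obtain ⟨X, Y, hX, hY, hzXY⟩ := z.2
  have hs := cDualEquiv_apply hσ z X Y hzXY
  rw [hs, map_add, hX, hY] at h
  -- `h` reads `X + Y = X - Y`, up to the form of the terms.
  have hY0 : Y = 0 := by linear_combination (norm := module) (2⁻¹ : ℝ) • h
  rw [hs, hzXY, hY0, tmul_zero, add_zero, add_zero]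

theorem coe_of_sigmaC_eq_neg (hσ : Function.Involutive σ) {z : cDual σ} (hz : sigmaC σ z = -z) :
    (z : ℂ ⊗[ℝ] g) = Complex.I ⊗ₜ[ℝ] cDualEquiv hσ z := by
  have h := cDualEquiv_sigmaC hσ z
  obtain ⟨X, Y, hX, hY, hzXY⟩ := z.2
  have hs := cDualEquiv_apply hσ z X Y hzXY
  rw [hz, map_neg, hs, map_add, hX, hY, neg_add] at h
  have hX0 : X = 0 := by linear_combination (norm := module) (-2⁻¹ : ℝ) • h
  rw [hs, hzXY, hX0, tmul_zero, zero_add, zero_add]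

theorem isDuality_cDualEquiv (hσ : Function.Involutive σ) :
    IsDuality σ (sigmaC σ) (cDualEquiv hσ) where
  involutive := hσ
  involutive' z := (cDualEquiv hσ).injective <| by
    rw [cDualEquiv_sigmaC, cDualEquiv_sigmaC, hσ]
  comm := cDualEquiv_sigmaC hσ
  lie_even x y hx := by
    obtain ⟨X, Y, -, -, hy⟩ := y.2
    obtain ⟨-, hx'⟩ := coe_of_sigmaC_eq hσ hx
    rw [cDualEquiv_apply hσ y X Y hy, cDualEquiv_apply hσ ⁅x, y⁆ ⁅cDualEquiv hσ x, X⁆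
      ⁅cDualEquiv hσ x, Y⁆, lie_add]
    rw [LieSubalgebra.coe_bracket, hx', hy]
    simp
  lie_odd x y hx hy := by
    have hx' := coe_of_sigmaC_eq_neg hσ hx
    have hy' := coe_of_sigmaC_eq_neg hσ hy
    -- The bracket of two elements of `√-1 q` has no imaginary component, and its real component
    -- carries the sign `(√-1)² = -1`.
    rw [cDualEquiv_apply hσ ⁅x, y⁆ (-⁅cDualEquiv hσ x, cDualEquiv hσ y⁆) 0, add_zero]
    rw [LieSubalgebra.coe_bracket, hx', hy']
    rw [LieAlgebra.ExtendScalars.bracket_tmul, Complex.I_mul_I, neg_tmul, tmul_neg, tmul_zero,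
      add_zero]

theorem mem_cDualFixed_iff (hσ : Function.Involutive σ) (z : cDual σ) :
    z ∈ cDualFixed σ ↔ sigmaC σ z = z := by
  constructor
  · rintro ⟨X, hX, hz⟩
    ext
    rw [sigmaC_apply z X 0 hX (by simp) (by simp [hz]), hz, tmul_zero, sub_zero]
  · intro hz
    exact ⟨_, coe_of_sigmaC_eq hσ hz⟩

theorem cDualEquiv_thetaC (hσ : Function.Involutive σ) {θ : g →ₗ⁅ℝ⁆ g}
    (hc : ∀ X, θ (σ X) = σ (θ X)) (z : cDual σ) :
    cDualEquiv hσ (thetaC hc z) = θ (σ (cDualEquiv hσ z)) := by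
  obtain ⟨X, Y, hX, hY, hz⟩ := z.2
  rw [cDualEquiv_apply hσ z X Y hz, cDualEquiv_apply hσ (thetaC hc z) (θ X) (-θ Y)
    (by rw [thetaC_apply hc z X Y hX hY hz, tmul_neg, sub_eq_add_neg]), map_add, map_add, hX, hY,
    map_neg]

end CDualEquiv

end CDual

end

theorem mainTheorem10 (g : Type*) [LieRing g] [LieAlgebra ℝ g] [FiniteDimensional ℝ g]
    [LieAlgebra.IsSemisimple ℝ g]
    (σ : g →ₗ⁅ℝ⁆ g) (hσ : Function.Involutive σ)
    (θ : g →ₗ⁅ℝ⁆ g) (hθ : CDual.IsCartanInvolution θ)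
    (hc : ∀ X, θ (σ X) = σ (θ X)) :
    CDual.RestrictionSurjective (CDual.fixed σ) θ (CDual.map_mem_fixed hc) ↔
      CDual.RestrictionSurjective (CDual.cDualFixed σ) (CDual.thetaC hc)
        (CDual.thetaC_mem hc) := by
  have hT := CDual.isDuality_cDualEquiv hσ
  have hθc := CDual.cDualEquiv_thetaC hσ hc
  -- The converse uses the inverse duality. It needs that `θ^c` commutes with the involution of
  -- `g^c` and, by `σ² = 1`, that `θ` corresponds to `θ^c` composed with that involution.
  refine ⟨hT.restrictionSurjective (fun _ => Iff.rfl) (CDual.mem_cDualFixed_iff hσ) hc hθc _ _,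
    hT.symm.restrictionSurjective (CDual.mem_cDualFixed_iff hσ) (fun _ => Iff.rfl)
      (fun z => (CDual.cDualEquiv hσ).injective ?_) (fun X => ?_) _ _⟩
  · rw [hθc, hT.comm, hT.comm, hθc, hc]
  · rw [LinearEquiv.symm_apply_eq, hθc, hT.comm, LinearEquiv.apply_symm_apply, hσ]
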